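/- Let $\lambda=(\lambda_1\ge\lambda_2\ge\cdots)$ and $\alpha$ be partitions with $\alpha\subseteq\lambda$ (identified with their Young diagrams in matrix coordinates), let $\lambda/\alpha$ be the skew diagram consisting of the boxes of $\lambda$ that are not boxes of $\alpha$, and let $n=|\lambda/\alpha|$ be its number of boxes. For a partition $\nu$ of $n$ let $[\nu]$ be the irreducible character of $S_n$ afforded by the complex Specht module $S^\nu$, and let $c(\lambda;\alpha,\nu)$ be the Littlewood–Richardson coefficient, i.e. the number of semistandard tableaux of shape $\lambda/\alpha$ and content $\nu$ whose reverse row word (the entries read from right to left in each row, rows from top to bottom) is a lattice word. The skew character $[\lambda/\alpha]$ of $S_n$ is $$[\lambda/\alpha]=\sum_{\nu\vdash n} c(\lambda;\alpha,\nu)\,[\nu].$$ A character is multiplicity-free if in its decomposition into irreducible characters all coefficients are $0$ or $1$. Proposition. Suppose that $\lambda/\alpha$ decomposes into three or more disconnected skew diagrams, i.e. that for some $k\ge 3$ the set of boxes of $\lambda/\alpha$ is the union of nonempty skew diagrams $A_1,\dots,A_k$ such that for $p\ne q$ no box of $A_p$ lies in the same row or in the same column as a box of $A_q$. Then $[\lambda/\alpha]$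 is not multiplicity-free. -/

import Mathlib

/-! ## Skew diagrams -/

/-- The skew diagram `lam / al`: the boxes of `lam` that are not boxes of `al`. A box is a pair
`(row, column)`; rows and columns are numbered from `0`. -/
def skewDiagram (lam al : YoungDiagram) : Finset (ℕ × ℕ) :=
  lam.cells \ al.cells

/-- A set of boxes is a skew diagram if it is `lam / al` for some partitions `al ⊆ lam`. -/
def IsSkewDiagram (D : Finset (ℕ × ℕ)) : Prop :=
  ∃ lam al : YoungDiagram, al ≤ lam ∧ D = skewDiagram lam al

/-- `D` decomposes into the (nonempty) disconnected skew diagrams `A 0, …, A (k - 1)`: it is their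
union, and no box of one of them is in the same row or the same column as a box of another. -/
structure DecomposesInto (D : Finset (ℕ × ℕ)) {k : ℕ} (A : Fin k → Finset (ℕ × ℕ)) : Prop where
  isSkewDiagram : ∀ p, IsSkewDiagram (A p)
  nonempty : ∀ p, (A p).Nonempty
  union : D = Finset.univ.biUnion A
  disconnected : ∀ p q, p ≠ q → ∀ a ∈ A p, ∀ b ∈ A q, a.1 ≠ b.1 ∧ a.2 ≠ b.2

/-! ## Littlewood-Richardson coefficients -/

/-- `ReadBefore c' c`: in the reverse row word (rows from top to bottom, each row from right to
left) the box `c'` is `c` or is read before `c`. -/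
def ReadBefore (c' c : ℕ × ℕ) : Prop :=
  c'.1 < c.1 ∨ (c'.1 = c.1 ∧ c.2 ≤ c'.2)

instance (c' c : ℕ × ℕ) : Decidable (ReadBefore c' c) :=
  inferInstanceAs (Decidable (_ ∨ _))

/-- Littlewood-Richardson tableaux of shape `lam / al` and content `nu`: semistandard fillings of
the skew diagram with positive integers (extended by `0` outside the diagram) such that the entry
`m + 1` occurs `nu_{m+1}` times and the reverse row word is a lattice word. The nonempty initial
segments of the reverse row word are the sets of boxes read no later than a given box `c`. -/
@[ext]
structure LRTableau (lam al nu : YoungDiagram) where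
  entry : ℕ → ℕ → ℕ
  zeros : ∀ i j, (i, j) ∉ skewDiagram lam al → entry i j = 0
  pos : ∀ i j, (i, j) ∈ skewDiagram lam al → 1 ≤ entry i j
  row_weak : ∀ i j, (i, j) ∈ skewDiagram lam al → (i, j + 1) ∈ skewDiagram lam al →
    entry i j ≤ entry i (j + 1)
  col_strict : ∀ i j, (i, j) ∈ skewDiagram lam al → (i + 1, j) ∈ skewDiagram lam al →
    entry i j < entry (i + 1) j
  content : ∀ m : ℕ,
    ((skewDiagram lam al).filter fun c => entry c.1 c.2 = m + 1).card = nu.rowLen m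
  lattice : ∀ c ∈ skewDiagram lam al, ∀ m : ℕ, 1 ≤ m →
    ((skewDiagram lam al).filter fun c' => ReadBefore c' c ∧ entry c'.1 c'.2 = m + 1).card ≤
      ((skewDiagram lam al).filter fun c' => ReadBefore c' c ∧ entry c'.1 c'.2 = m).card

theorem LRTableau.entry_le {lam al nu : YoungDiagram} (T : LRTableau lam al nu) (i j : ℕ) :
    T.entry i j ≤ nu.colLen 0 := by
  by_cases hij : (i, j) ∈ skewDiagram lam al
  · obtain ⟨m, hm⟩ : ∃ m, T.entry i j = m + 1 := ⟨T.entry i j - 1, by have := T.pos i j hij; omega⟩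
    have h1 : 0 < nu.rowLen m := by
      rw [← T.content m]
      exact Finset.card_pos.mpr ⟨(i, j), by simp [hij, hm]⟩
    have h2 := YoungDiagram.mem_iff_lt_colLen.mp (YoungDiagram.mem_iff_lt_rowLen.mpr h1)
    omega
  · simp [T.zeros i j hij]

instance (lam al nu : YoungDiagram) : Finite (LRTableau lam al nu) := by
  let F : LRTableau lam al nu → (skewDiagram lam al → Fin (nu.colLen 0 + 1)) :=
    fun T c => ⟨T.entry c.1.1 c.1.2, Nat.lt_succ_of_le (T.entry_le _ _)⟩
  refine Finite.of_injective F fun S T h => ?_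
  ext i j
  by_cases hij : (i, j) ∈ skewDiagram lam al
  · exact congrArg Fin.val (congrFun h ⟨(i, j), hij⟩)
  · rw [S.zeros i j hij, T.zeros i j hij]

/-- The Littlewood-Richardson coefficient `c(lam; al, nu)`. -/
noncomputable def lrCoeff (lam al nu : YoungDiagram) : ℕ :=
  Nat.card (LRTableau lam al nu)

/-! ## Specht modules and the characters of the symmetric groups -/

/-- Tabloids of shape `nu` with entries in `Fin n`: the function sends an entry to the number of
the row that contains it. -/
def Tabloid (n : ℕ) (nu : YoungDiagram) : Type :=
  {f : Fin n → ℕ // ∀ i, (Finset.univ.filter fun x => f x = i).card = nu.rowLen i}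

/-- `S_n` acts on tabloids by permuting the entries. -/
instance (n : ℕ) (nu : YoungDiagram) : MulAction (Equiv.Perm (Fin n)) (Tabloid n nu) where
  smul s f := ⟨fun x => f.1 (s⁻¹ x), fun i => by
    rw [← f.2 i]
    exact Finset.card_equiv s⁻¹ (by simp)⟩
  one_smul f := rfl
  mul_smul s t f := by
    apply Subtype.ext
    funext x
    change f.1 ((s * t)⁻¹ x) = f.1 (t⁻¹ (s⁻¹ x))
    rw [mul_inv_rev]
    rfl

/-- Bijective tableaux of shape `nu` with entries in `Fin n`; there are none unless `nu` has
exactly `n` boxes. -/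
abbrev YoungTableau (n : ℕ) (nu : YoungDiagram) : Type :=
  nu.cells ≃ Fin n

/-- The tabloid of a tableau. -/
def YoungTableau.tabloid {n : ℕ} {nu : YoungDiagram} (t : YoungTableau n nu) : Tabloid n nu :=
  ⟨fun x => (t.symm x).1.1, fun i => by
    rw [YoungDiagram.rowLen_eq_card]
    refine Finset.card_bij (fun x _ => (t.symm x).1) ?_ ?_ ?_
    · intro x hx
      rw [YoungDiagram.mem_row_iff]
      exact ⟨(t.symm x).2, by simpa using hx⟩
    · intro x _ y _ h
      exact t.symm.injective (Subtype.ext h)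
    · intro c hc
      rw [YoungDiagram.mem_row_iff] at hc
      exact ⟨t ⟨c, hc.1⟩, by simp [hc.2], by simp⟩⟩

/-- The permutation `p` maps every column of the tableau `t` to itself. -/
def YoungTableau.IsColumnStable {n : ℕ} {nu : YoungDiagram} (t : YoungTableau n nu)
    (p : Equiv.Perm (Fin n)) : Prop :=
  ∀ x, (t.symm (p x)).1.2 = (t.symm x).1.2

instance {n : ℕ} {nu : YoungDiagram} (t : YoungTableau n nu) (p : Equiv.Perm (Fin n)) :
    Decidable (t.IsColumnStable p) :=
  inferInstanceAs (Decidable (∀ _, _))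

/-- The permutation representation of `S_n` on the complex vector space with basis the tabloids
of shape `nu`. -/
noncomputable abbrev tabloidRep (n : ℕ) (nu : YoungDiagram) :=
  Representation.ofMulAction ℂ (Equiv.Perm (Fin n)) (Tabloid n nu)

/-- The polytabloid `e_t = ∑ sgn(p) {p t}`, summed over the column stabilizer of `t`. -/
noncomputable def YoungTableau.polytabloid {n : ℕ} {nu : YoungDiagram} (t : YoungTableau n nu) :
    MonoidAlgebra ℂ (Tabloid n nu) :=
  ∑ p : Equiv.Perm (Fin n) with t.IsColumnStable p,
    MonoidAlgebra.single (p • t.tabloid) ((Equiv.Perm.sign p : ℤ) : ℂ)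

theorem YoungTableau.tabloid_trans {n : ℕ} {nu : YoungDiagram} (t : YoungTableau n nu)
    (s : Equiv.Perm (Fin n)) :
    YoungTableau.tabloid (t.trans s : YoungTableau n nu) = s • t.tabloid := rfl

theorem YoungTableau.tabloidRep_polytabloid {n : ℕ} {nu : YoungDiagram} (t : YoungTableau n nu)
    (s : Equiv.Perm (Fin n)) :
    tabloidRep n nu s t.polytabloid =
      YoungTableau.polytabloid (t.trans s : YoungTableau n nu) := by
  unfold YoungTableau.polytabloid
  rw [map_sum]
  refine Finset.sum_equiv (MulAut.conj s).toEquiv ?_ ?_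
  · intro p
    rw [Finset.mem_filter, Finset.mem_filter]
    refine and_congr (by simp) ⟨fun h x => ?_, fun h x => ?_⟩
    · simpa using h (s⁻¹ x)
    · simpa using h (s x)
  · intro p _
    have hs : Equiv.Perm.sign (s * p * s⁻¹) = Equiv.Perm.sign p := by
      rw [map_mul, map_mul, map_inv, mul_comm, inv_mul_cancel_left]
    rw [Representation.ofMulAction_single, YoungTableau.tabloid_trans]
    simp only [MulEquiv.toEquiv_eq_coe, EquivLike.coe_coe, MulAut.conj_apply, hs, smul_smul,
      inv_mul_cancel_right]

/-- The Specht module `S^nu`: the subrepresentation spanned by the polytabloids of shape `nu`.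
It is the zero representation if `nu` does not have exactly `n` boxes. -/
noncomputable def spechtModule (n : ℕ) (nu : YoungDiagram) :
    Subrepresentation (tabloidRep n nu) where
  toSubmodule := Submodule.span ℂ (Set.range YoungTableau.polytabloid)
  apply_mem_toSubmodule s v hv := by
    induction hv using Submodule.span_induction with
    | mem x hx =>
      obtain ⟨t, rfl⟩ := hx
      rw [YoungTableau.tabloidRep_polytabloid]
      exact Submodule.subset_span ⟨_, rfl⟩
    | zero => simp
    | add x y _ _ hx hy => rw [map_add]; exact Submodule.add_mem _ hx hy
    | smul a x _ hx => rw [map_smul]; exact Submodule.smul_mem _ a hx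

/-- The character `[nu]` of the Specht module `S^nu` of `S_n`, where `nu` has `n` boxes. -/
noncomputable def spechtCharacter (n : ℕ) (nu : YoungDiagram) : Equiv.Perm (Fin n) → ℂ :=
  (spechtModule n nu).toRepresentation.character

/-- The partitions of `n`, as Young diagrams. -/
abbrev PartitionOf (n : ℕ) : Type :=
  {nu : YoungDiagram // nu.card = n}

instance (n : ℕ) : Finite (PartitionOf n) := by
  have hmem : ∀ nu : PartitionOf n, nu.1.cells ∈ (Finset.range n ×ˢ Finset.range n).powerset := by
    rintro ⟨nu, hn⟩
    rw [Finset.mem_powerset]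
    rintro ⟨i, j⟩ hij
    rw [YoungDiagram.mem_cells] at hij
    rw [Finset.mem_product, Finset.mem_range, Finset.mem_range]
    constructor
    · have h1 : nu.colLen j ≤ n := by
        rw [YoungDiagram.colLen_eq_card, ← hn]
        exact Finset.card_le_card (Finset.filter_subset _ _)
      exact (YoungDiagram.mem_iff_lt_colLen.mp hij).trans_le h1
    · have h1 : nu.rowLen i ≤ n := by
        rw [YoungDiagram.rowLen_eq_card, ← hn]
        exact Finset.card_le_card (Finset.filter_subset _ _)
      exact (YoungDiagram.mem_iff_lt_rowLen.mp hij).trans_le h1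
  refine Finite.of_injective
    (β := ((Finset.range n ×ˢ Finset.range n).powerset : Finset (Finset (ℕ × ℕ))))
    (fun nu => ⟨nu.1.cells, hmem nu⟩) fun x y h => ?_
  exact Subtype.ext (YoungDiagram.ext (congrArg Subtype.val h))

noncomputable instance (n : ℕ) : Fintype (PartitionOf n) :=
  Fintype.ofFinite _

/-- The skew character `[lam/al] = ∑ c(lam; al, nu) [nu]` of `S_n`, where `n` is the number of
boxes of `lam/al` and `nu` runs over the partitions of `n`. -/
noncomputable def skewCharacter (lam al : YoungDiagram) :
    Equiv.Perm (Fin (skewDiagram lam al).card) → ℂ :=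
  fun s => ∑ nu : PartitionOf (skewDiagram lam al).card,
    (lrCoeff lam al nu.1 : ℂ) * spechtCharacter (skewDiagram lam al).card nu.1 s

/-! ## Multiplicity-freeness -/

/-- The scalar product of two class functions on a finite group; if `psi` is an irreducible
character, this is the coefficient of `psi` in the decomposition of `chi` into irreducible
characters. -/
noncomputable def charInner {G : Type} [Group G] [Fintype G] (chi psi : G → ℂ) : ℂ :=
  (Nat.card G : ℂ)⁻¹ * ∑ g : G, chi g * psi g⁻¹

/-- A character of a finite group is multiplicity-free if in its decomposition into irreducible
complex characters all coefficients are `0` or `1`. -/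
def IsMultiplicityFree {G : Type} [Group G] [Fintype G] (chi : G → ℂ) : Prop :=
  ∀ (V : Type) [AddCommGroup V] [Module ℂ V] [FiniteDimensional ℂ V]
    (rho : Representation ℂ G V), rho.IsIrreducible →
      charInner chi rho.character = 0 ∨ charInner chi rho.character = 1

/-! It suffices to find one `nu` with Littlewood-Richardson coefficient at least 2. No
irreducibility of Specht modules is needed for this: the Specht module of `nu` is nonzero, so some
irreducible σ maps nontrivially into it. The multiplicity of σ in the skew character is a sum of
natural numbers c(lam; al, mu) · dim Hom(σ, S^mu), and the term for `nu` alone is at least 2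
(`not_isMultiplicityFree_skewCharacter`).

To find `nu`, take the last columns of three components, of lengths p, q, r from top to bottom, and
fill every other column with 1, 2, …. The three columns behave as in the product e_p e_q e_r under
the dual Pieri rule. The first two combine to column lengths (p+q-i, i), and the third is a vertical
strip leading to (X, Y, x). This requires i ≤ min(p, q) and x ≤ i ≤ Y ≤ p+q-i ≤ X, which together
with the total size is `ColumnTriple.Admissible`. The content (max+1, median, min-1) is reached
through both i = min(p,q)-1 and i = min(p,q) (`ColumnTriple.exists_admissible`), which gives two
tableaux of equal content.

The lattice condition is certified by splitting the filling into chains 1, 2, …, each going strictly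
down the diagram (`ChainLabelling`). The chain lengths are then the column lengths of the content.
-/

/-! ## Scalar products of characters -/

namespace Representation

variable {G V W : Type*} [Group G] [AddCommGroup V] [Module ℂ V] [AddCommGroup W] [Module ℂ W]

/-- A nonzero finite-dimensional representation has an irreducible subrepresentation. -/
theorem exists_isIrreducible_subrepresentation [FiniteDimensional ℂ V] [Nontrivial V]
    (ρ : Representation ℂ G V) : ∃ U : Subrepresentation ρ, U.toRepresentation.IsIrreducible := by
  have hne : ∃ U : Subrepresentation ρ, U.toSubmodule ≠ ⊥ := ⟨⊤, top_ne_bot⟩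
  obtain ⟨U, hU, hmin⟩ := WellFounded.has_min
    (InvImage.wf (fun U : Subrepresentation ρ => Module.finrank ℂ U.toSubmodule) wellFounded_lt)
    {U | U.toSubmodule ≠ ⊥} hne
  refine ⟨U, ?_⟩
  have hnt : Nontrivial U.toSubmodule := Submodule.nontrivial_iff_ne_bot.mpr hU
  have : Nontrivial (Subrepresentation U.toRepresentation) :=
    ⟨⊥, ⊤, fun h => bot_ne_top (α := Submodule ℂ U.toSubmodule)
      (congrArg Subrepresentation.toSubmodule h)⟩
  refine ⟨fun S => ?_⟩
  by_cases hS : S.toSubmodule = ⊥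
  · exact Or.inl (Subrepresentation.toSubmodule_injective hS)
  · right
    apply Subrepresentation.toSubmodule_injective
    -- Viewed inside `V`, a nonzero `S` competes with `U` for least dimension, so it must fill `U`.
    let T : Subrepresentation ρ :=
      { toSubmodule := S.toSubmodule.map U.toSubmodule.subtype
        apply_mem_toSubmodule := by
          rintro g _ ⟨x, hx, rfl⟩
          exact ⟨_, S.apply_mem_toSubmodule g hx, rfl⟩ }
    have hrank : Module.finrank ℂ T.toSubmodule = Module.finrank ℂ S.toSubmodule :=
      Submodule.finrank_map_subtype_eq _ _
    have hT : T.toSubmodule ≠ ⊥ := fun h => hS <| by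
      rwa [← Submodule.finrank_eq_zero, ← hrank, Submodule.finrank_eq_zero]
    have h := hmin T hT
    simp only [InvImage, hrank, not_lt] at h
    exact Submodule.eq_top_of_finrank_eq (le_antisymm (Submodule.finrank_le _) h)

/-- A nonzero finite-dimensional representation has a nonzero map from an irreducible one. -/
theorem exists_isIrreducible_nontrivial_intertwiningMap {G V : Type} [Group G] [AddCommGroup V]
    [Module ℂ V] [FiniteDimensional ℂ V] [Nontrivial V] (ρ : Representation ℂ G V) :
    ∃ (U : Type) (_ : AddCommGroup U) (_ : Module ℂ U) (_ : FiniteDimensional ℂ U)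
      (σ : Representation ℂ G U), σ.IsIrreducible ∧ Nontrivial (IntertwiningMap σ ρ) := by
  obtain ⟨U, hU⟩ := ρ.exists_isIrreducible_subrepresentation
  refine ⟨U.toSubmodule, inferInstance, inferInstance, inferInstance, U.toRepresentation, hU, ?_⟩
  let f : IntertwiningMap U.toRepresentation ρ := ⟨U.toSubmodule.subtype, fun _ => rfl⟩
  refine ⟨f, 0, fun h => bot_ne_top (α := Subrepresentation U.toRepresentation)
    (Subrepresentation.toSubmodule_injective ?_)⟩
  refine (Submodule.eq_bot_iff _ |>.mpr fun u _ => ?_).symm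
  exact Subtype.ext (congrArg (fun g : IntertwiningMap U.toRepresentation ρ => g u) h)

end Representation

/-- The scalar product of two characters is a dimension. -/
theorem charInner_character {G V W : Type} [Group G] [Fintype G] [AddCommGroup V] [Module ℂ V]
    [FiniteDimensional ℂ V] [AddCommGroup W] [Module ℂ W] [FiniteDimensional ℂ W]
    (ρ : Representation ℂ G V) (σ : Representation ℂ G W) :
    charInner σ.character ρ.character =
      Module.finrank ℂ (Representation.IntertwiningMap ρ σ) := by
  have : Invertible (Nat.card G : ℂ) := invertibleOfNonzero (by simp)
  exact Representation.card_inv_mul_sum_char_mul_char_eq_finrank ρ σ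

theorem charInner_sum {G ι : Type} [Group G] [Fintype G] (s : Finset ι) (c : ι → ℂ)
    (chi : ι → G → ℂ) (psi : G → ℂ) :
    charInner (fun g => ∑ i ∈ s, c i * chi i g) psi = ∑ i ∈ s, c i * charInner (chi i) psi := by
  simp only [charInner, Finset.sum_mul, Finset.mul_sum]
  rw [Finset.sum_comm]
  exact Finset.sum_congr rfl fun i _ => Finset.sum_congr rfl fun g _ => by ring

/-! ## Specht modules are nonzero -/

instance (n : ℕ) (nu : YoungDiagram) : FiniteDimensional ℂ (spechtModule n nu).toSubmodule :=
  FiniteDimensional.span_of_finite ℂ (Set.finite_range _)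

/-- Fixing the tabloid keeps every entry in its row, column stability keeps it in its column, and
row and column determine the box. -/
theorem YoungTableau.eq_one_of_smul_tabloid {n : ℕ} {nu : YoungDiagram} (t : YoungTableau n nu)
    {p : Equiv.Perm (Fin n)} (hp : t.IsColumnStable p) (h : p • t.tabloid = t.tabloid) : p = 1 := by
  ext1 x
  apply t.symm.injective
  apply Subtype.ext
  refine Prod.ext ?_ (hp x)
  have h1 := congrFun (congrArg Subtype.val h) (p x)
  change (t.symm (p⁻¹ (p x))).1.1 = (t.symm (p x)).1.1 at h1
  simpa using h1.symm

/-- Only the identity contributes to the coefficient of the tabloid of `t` itself, which is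
therefore 1. -/
theorem YoungTableau.polytabloid_ne_zero {n : ℕ} {nu : YoungDiagram} (t : YoungTableau n nu) :
    t.polytabloid ≠ 0 := by
  classical
  intro h
  have h1 : t.polytabloid.coeff t.tabloid = 1 := by
    unfold YoungTableau.polytabloid
    rw [MonoidAlgebra.coeff_sum, Finsupp.finsetSum_apply, Finset.sum_eq_single 1]
    · simp
    · intro p hp hp1
      rw [MonoidAlgebra.coeff_single, Finsupp.single_apply, if_neg]
      exact fun hpt => hp1 (t.eq_one_of_smul_tabloid (Finset.mem_filter.mp hp).2 hpt)
    · intro h1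
      exact absurd (Finset.mem_filter.mpr ⟨Finset.mem_univ _, fun x => rfl⟩) h1
  rw [h] at h1
  simp at h1

theorem nontrivial_spechtModule {n : ℕ} {nu : YoungDiagram} (h : nu.card = n) :
    Nontrivial (spechtModule n nu).toSubmodule := by
  rw [Submodule.nontrivial_iff_ne_bot]
  have t : YoungTableau n nu := Finset.equivFinOfCardEq h
  intro hb
  have hm : t.polytabloid ∈ (spechtModule n nu).toSubmodule := Submodule.subset_span ⟨t, rfl⟩
  rw [hb, Submodule.mem_bot] at hm
  exact t.polytabloid_ne_zero hm

/-- A skew character is not multiplicity-free if some Littlewood-Richardson coefficient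
exceeds `1`. -/
theorem not_isMultiplicityFree_skewCharacter {lam al nu : YoungDiagram}
    (hcard : nu.card = (skewDiagram lam al).card) (hc : 2 ≤ lrCoeff lam al nu) :
    ¬ IsMultiplicityFree (skewCharacter lam al) := by
  intro hfree
  have := nontrivial_spechtModule hcard
  obtain ⟨U, _, _, _, σ, hσ, hnt⟩ :=
    (spechtModule (skewDiagram lam al).card nu).toRepresentation
      |>.exists_isIrreducible_nontrivial_intertwiningMap
  let d : PartitionOf (skewDiagram lam al).card → ℕ := fun mu =>
    Module.finrank ℂ (Representation.IntertwiningMap σ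
      (spechtModule (skewDiagram lam al).card mu.1).toRepresentation)
  have hsum : charInner (skewCharacter lam al) σ.character =
      ((∑ mu : PartitionOf (skewDiagram lam al).card, lrCoeff lam al mu.1 * d mu : ℕ) : ℂ) := by
    unfold skewCharacter
    rw [charInner_sum]
    push_cast
    exact Finset.sum_congr rfl fun mu _ => congrArg _ (charInner_character _ _)
  have hd : 1 ≤ d ⟨nu, hcard⟩ := Module.finrank_pos (R := ℂ)
    (M := Representation.IntertwiningMap σ
      (spechtModule (skewDiagram lam al).card nu).toRepresentation)
  have h2 : 2 ≤ ∑ mu : PartitionOf (skewDiagram lam al).card, lrCoeff lam al mu.1 * d mu :=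
    (le_mul_of_le_of_one_le hc hd).trans <| Finset.single_le_sum
      (f := fun mu : PartitionOf (skewDiagram lam al).card => lrCoeff lam al mu.1 * d mu)
      (fun _ _ => Nat.zero_le _) (Finset.mem_univ ⟨nu, hcard⟩)
  rcases hfree U σ hσ with h | h <;> rw [hsum] at h <;> norm_cast at h <;> omega

/-! ## Littlewood-Richardson tableaux from chain labellings -/

/-- The diagram whose columns have the lengths `len 0, …, len (N - 1)`, in decreasing order. -/
def YoungDiagram.ofColumnLengths (N : ℕ) (len : ℕ → ℕ) : YoungDiagram where
  -- The sum is a crude bound for every column length; it only serves to make the set of cells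
  -- finite.
  cells := ((Finset.range (∑ L ∈ Finset.range N, len L)) ×ˢ Finset.range N).filter
    fun c => c.2 < ((Finset.range N).filter fun L => c.1 + 1 ≤ len L).card
  isLowerSet := by
    rintro ⟨a, b⟩ ⟨a', b'⟩ ⟨h1, h2⟩ h
    simp only [Finset.coe_filter, Finset.mem_product, Finset.mem_range, Set.mem_ofPred_eq]
      at h h1 h2 ⊢
    refine ⟨⟨by omega, by omega⟩, lt_of_le_of_lt h2 (h.2.trans_le (Finset.card_le_card ?_))⟩
    exact Finset.monotone_filter_right _ fun L _ hL => by omega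

theorem YoungDiagram.rowLen_ofColumnLengths (N : ℕ) (len : ℕ → ℕ) (m : ℕ) :
    (YoungDiagram.ofColumnLengths N len).rowLen m =
      ((Finset.range N).filter fun L => m + 1 ≤ len L).card := by
  refine eq_of_forall_lt_iff fun t => ?_
  rw [← YoungDiagram.mem_iff_lt_rowLen, ← YoungDiagram.mem_cells]
  simp only [YoungDiagram.ofColumnLengths, Finset.mem_filter, Finset.mem_product, Finset.mem_range,
    and_iff_right_iff_imp]
  intro ht
  refine ⟨?_, ht.trans_le ((Finset.card_filter_le _ _).trans (Finset.card_range N).le)⟩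
  obtain ⟨L, hL⟩ := Finset.card_pos.mp (Nat.zero_lt_of_lt ht)
  rw [Finset.mem_filter] at hL
  exact hL.2.trans (Finset.single_le_sum (fun _ _ => Nat.zero_le _) hL.1)

theorem YoungDiagram.card_eq_sum_rowLen (nu : YoungDiagram) {K : ℕ} (hK : nu.colLen 0 ≤ K) :
    nu.card = ∑ m ∈ Finset.range K, nu.rowLen m := by
  unfold YoungDiagram.card
  rw [Finset.card_eq_sum_card_fiberwise (f := Prod.fst) (t := Finset.range K)]
  · exact Finset.sum_congr rfl fun m _ => (nu.rowLen_eq_card).symm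
  · rintro ⟨a, b⟩ h
    have h0 : (a, 0) ∈ nu := nu.up_left_mem le_rfl (Nat.zero_le b) h
    exact Finset.mem_coe.mpr
      (Finset.mem_range.mpr ((YoungDiagram.mem_iff_lt_colLen.mp h0).trans_le hK))

theorem LRTableau.card_eq {lam al nu : YoungDiagram} (T : LRTableau lam al nu) :
    nu.card = (skewDiagram lam al).card := by
  rw [nu.card_eq_sum_rowLen le_rfl, Finset.card_eq_sum_card_fiberwise
    (f := fun c : ℕ × ℕ => T.entry c.1 c.2 - 1) (t := Finset.range (nu.colLen 0))]
  · refine Finset.sum_congr rfl fun m _ => ?_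
    rw [← T.content m]
    refine congrArg _ (Finset.filter_congr fun c hc => ?_)
    have := T.pos c.1 c.2 hc
    omega
  · intro c hc
    have h1 := T.pos c.1 c.2 hc
    have h2 := T.entry_le c.1 c.2
    exact Finset.mem_coe.mpr (Finset.mem_range.mpr (by
      change T.entry c.1 c.2 - 1 < _
      omega))

/-- A labelling of the boxes that splits a filling of `D` into chains: the boxes with label `L`
have the entries `1, …, len L`, once each, from top to bottom. -/
structure ChainLabelling (D : Finset (ℕ × ℕ)) (e : ℕ × ℕ → ℕ) (len : ℕ → ℕ) where
  label : ℕ × ℕ → ℕ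
  entry_le : ∀ c ∈ D, e c ≤ len (label c)
  exists_box : ∀ L v, 1 ≤ v → v ≤ len L → ∃ c ∈ D, label c = L ∧ e c = v
  injective : ∀ c ∈ D, ∀ c' ∈ D, label c = label c' → e c = e c' → c = c'
  row_lt : ∀ c ∈ D, ∀ c' ∈ D, label c = label c' → e c < e c' → c.1 < c'.1

namespace ChainLabelling

variable {D : Finset (ℕ × ℕ)} {e : ℕ × ℕ → ℕ} {len : ℕ → ℕ}

/-- Each chain of length at least m + 1 contains the entry m + 1 exactly once, and shorter chains do
not contain it. -/
theorem card_filter_entry_eq (W : ChainLabelling D e len) {N : ℕ} (hN : ∀ L, N ≤ L → len L = 0)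
    (m : ℕ) : (D.filter fun c => e c = m + 1).card =
      ((Finset.range N).filter fun L => m + 1 ≤ len L).card := by
  refine Finset.card_bij (fun c _ => W.label c) ?_ ?_ ?_
  · intro c hc
    rw [Finset.mem_filter] at hc
    have h := W.entry_le c hc.1
    rw [Finset.mem_filter, Finset.mem_range]
    refine ⟨?_, by omega⟩
    by_contra hL
    have := hN _ (not_lt.mp hL)
    omega
  · intro c hc c' hc' h
    rw [Finset.mem_filter] at hc hc'
    exact W.injective c hc.1 c' hc'.1 h (hc.2.trans hc'.2.symm)
  · intro L hL
    rw [Finset.mem_filter] at hL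
    obtain ⟨c, hc, hcL, hcv⟩ := W.exists_box L (m + 1) (by omega) hL.2
    exact ⟨c, Finset.mem_filter.mpr ⟨hc, hcv⟩, hcL⟩

/-- The m in the chain of a given m + 1 lies in a higher row, hence is read earlier; distinct
occurrences of m + 1 lie in distinct chains. -/
theorem lattice (W : ChainLabelling D e len) (c : ℕ × ℕ) (m : ℕ) (hm : 1 ≤ m) :
    (D.filter fun c' => ReadBefore c' c ∧ e c' = m + 1).card ≤
      (D.filter fun c' => ReadBefore c' c ∧ e c' = m).card := by
  rw [← Finset.card_image_of_injOn (f := W.label)]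
  · refine (Finset.card_le_card ?_).trans (Finset.card_image_le (f := W.label))
    intro L hL
    obtain ⟨b, hb, rfl⟩ := Finset.mem_image.mp hL
    rw [Finset.mem_filter] at hb
    obtain ⟨hbD, hbc, hbm⟩ := hb
    have hle := W.entry_le b hbD
    obtain ⟨a, ha, haL, ham⟩ := W.exists_box (W.label b) m hm (by omega)
    have hab := W.row_lt a ha b hbD haL (by omega)
    refine Finset.mem_image.mpr ⟨a, Finset.mem_filter.mpr ⟨ha, Or.inl ?_, ham⟩, haL⟩
    rcases hbc with h | h <;> omega
  · intro a ha b hb h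
    rw [Finset.mem_coe, Finset.mem_filter] at ha hb
    exact W.injective a ha.1 b hb.1 h (ha.2.2.trans hb.2.2.symm)

/-- A semistandard filling with a chain labelling is a Littlewood-Richardson tableau. -/
def toLRTableau {lam al : YoungDiagram} (W : ChainLabelling (skewDiagram lam al) e len)
    {N : ℕ} (hN : ∀ L, N ≤ L → len L = 0)
    (pos : ∀ c ∈ skewDiagram lam al, 1 ≤ e c)
    (row_weak : ∀ i j, (i, j) ∈ skewDiagram lam al → (i, j + 1) ∈ skewDiagram lam al →
      e (i, j) ≤ e (i, j + 1))
    (col_strict : ∀ i j, (i, j) ∈ skewDiagram lam al → (i + 1, j) ∈ skewDiagram lam al →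
      e (i, j) < e (i + 1, j)) :
    LRTableau lam al (YoungDiagram.ofColumnLengths N len) where
  entry i j := if (i, j) ∈ skewDiagram lam al then e (i, j) else 0
  zeros i j h := if_neg h
  pos i j h := by rw [if_pos h]; exact pos _ h
  row_weak i j h h' := by rw [if_pos h, if_pos h']; exact row_weak i j h h'
  col_strict i j h h' := by rw [if_pos h, if_pos h']; exact col_strict i j h h'
  content m := by
    rw [YoungDiagram.rowLen_ofColumnLengths, ← W.card_filter_entry_eq hN]
    exact congrArg _ (Finset.filter_congr fun c hc => by rw [if_pos hc])
  lattice c _ m hm := by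
    have h := W.lattice c m hm
    have key : ∀ v, (skewDiagram lam al).filter (fun c' => ReadBefore c' c ∧
        (if (c'.1, c'.2) ∈ skewDiagram lam al then e (c'.1, c'.2) else 0) = v) =
        (skewDiagram lam al).filter fun c' => ReadBefore c' c ∧ e c' = v := fun v =>
      Finset.filter_congr fun c' hc' => by rw [if_pos hc']
    rwa [key, key]

end ChainLabelling

/-! ## Three columns -/

theorem mem_skewDiagram_iff {lam al : YoungDiagram} {i j : ℕ} :
    (i, j) ∈ skewDiagram lam al ↔ al.colLen j ≤ i ∧ i < lam.colLen j := by
  rw [skewDiagram, Finset.mem_sdiff, YoungDiagram.mem_cells, YoungDiagram.mem_cells,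
    YoungDiagram.mem_iff_lt_colLen, YoungDiagram.mem_iff_lt_colLen, not_lt, and_comm]

/-- Three nonempty columns of `lam / al`, each of them without boxes to its right, the first one
above the second one and the second one above the third one. -/
structure ColumnTriple (lam al : YoungDiagram) where
  (j₁ j₂ j₃ : ℕ)
  lt₁₂ : j₂ < j₁
  lt₂₃ : j₃ < j₂
  nonempty₁ : al.colLen j₁ < lam.colLen j₁
  nonempty₂ : al.colLen j₂ < lam.colLen j₂
  nonempty₃ : al.colLen j₃ < lam.colLen j₃
  above₁₂ : lam.colLen j₁ ≤ al.colLen j₂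
  above₂₃ : lam.colLen j₂ ≤ al.colLen j₃
  right_end : ∀ i j, (i, j) ∈ skewDiagram lam al → (i, j + 1) ∈ skewDiagram lam al →
    j ≠ j₁ ∧ j ≠ j₂ ∧ j ≠ j₃

namespace ColumnTriple

variable {lam al : YoungDiagram} (C : ColumnTriple lam al)

/-- The column lengths of the content, before sorting: three columns of `lam / al` are replaced by
columns of lengths `X`, `Y`, `x`. -/
def len (X Y x L : ℕ) : ℕ :=
  if L = C.j₁ then X else if L = C.j₂ then Y else if L = C.j₃ then x else
    lam.colLen L - al.colLen L

/-- Every column is filled with `1, 2, …`, except that the second column is filled with `1, …, i`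
followed by numbers that extend the first column, and the third column with `1, …, x`, then
`i + 1, …, Y`, and then numbers that extend the first column further. -/
def entry (i Y x : ℕ) (c : ℕ × ℕ) : ℕ :=
  let k := c.1 - al.colLen c.2
  let p := lam.colLen C.j₁ - al.colLen C.j₁
  let q := lam.colLen C.j₂ - al.colLen C.j₂
  if c.2 = C.j₂ ∧ i ≤ k then p + k + 1 - i
  else if c.2 = C.j₃ ∧ x + Y ≤ k + i then p + q + k + 1 - x - Y
  else if c.2 = C.j₃ ∧ x ≤ k then i + k + 1 - x
  else k + 1

/-- The chain to which a box belongs. -/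
def label (i Y x : ℕ) (c : ℕ × ℕ) : ℕ :=
  let k := c.1 - al.colLen c.2
  if c.2 = C.j₂ ∧ i ≤ k then C.j₁
  else if c.2 = C.j₃ ∧ x + Y ≤ k + i then C.j₁
  else if c.2 = C.j₃ ∧ x ≤ k then C.j₂
  else c.2

/-- The conditions under which the filling is a Littlewood-Richardson tableau. -/
structure Admissible (i X Y x : ℕ) : Prop where
  x_le : x ≤ i
  le_left : i ≤ lam.colLen C.j₁ - al.colLen C.j₁
  le_right : i ≤ lam.colLen C.j₂ - al.colLen C.j₂
  le_Y : i ≤ Y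
  Y_le : Y + i ≤ (lam.colLen C.j₁ - al.colLen C.j₁) + (lam.colLen C.j₂ - al.colLen C.j₂)
  le_X : (lam.colLen C.j₁ - al.colLen C.j₁) + (lam.colLen C.j₂ - al.colLen C.j₂) ≤ X + i
  sum_eq : X + Y + x = (lam.colLen C.j₁ - al.colLen C.j₁) +
    (lam.colLen C.j₂ - al.colLen C.j₂) + (lam.colLen C.j₃ - al.colLen C.j₃)

/-! ### The filling of a column triple: semistandardness and chains. -/

variable {C} {i X Y x : ℕ}

/-- Flattens the nested conditionals into six linear cases (two pieces of the second column, three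
of the third, all other columns), so that `omega` can settle the later verifications. -/
theorem entry_label_cases (r j : ℕ) (hc : (r, j) ∈ skewDiagram lam al) :
    (j = C.j₂ ∧ C.label i Y x (r, j) = C.j₁ ∧ i ≤ r - al.colLen C.j₂ ∧
      C.entry i Y x (r, j) =
        lam.colLen C.j₁ - al.colLen C.j₁ + (r - al.colLen C.j₂) + 1 - i ∧
      al.colLen C.j₂ ≤ r ∧ r < lam.colLen C.j₂) ∨
    (j = C.j₂ ∧ C.label i Y x (r, j) = C.j₂ ∧ r - al.colLen C.j₂ < i ∧
      C.entry i Y x (r, j) = r - al.colLen C.j₂ + 1 ∧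
      al.colLen C.j₂ ≤ r ∧ r < lam.colLen C.j₂) ∨
    (j = C.j₃ ∧ C.label i Y x (r, j) = C.j₁ ∧ x + Y ≤ r - al.colLen C.j₃ + i ∧
      C.entry i Y x (r, j) = lam.colLen C.j₁ - al.colLen C.j₁ +
        (lam.colLen C.j₂ - al.colLen C.j₂) + (r - al.colLen C.j₃) + 1 - x - Y ∧
      al.colLen C.j₃ ≤ r ∧ r < lam.colLen C.j₃) ∨
    (j = C.j₃ ∧ C.label i Y x (r, j) = C.j₂ ∧ r - al.colLen C.j₃ + i < x + Y ∧
      x ≤ r - al.colLen C.j₃ ∧ C.entry i Y x (r, j) = i + (r - al.colLen C.j₃) + 1 - x ∧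
      al.colLen C.j₃ ≤ r ∧ r < lam.colLen C.j₃) ∨
    (j = C.j₃ ∧ C.label i Y x (r, j) = C.j₃ ∧ r - al.colLen C.j₃ + i < x + Y ∧
      r - al.colLen C.j₃ < x ∧ C.entry i Y x (r, j) = r - al.colLen C.j₃ + 1 ∧
      al.colLen C.j₃ ≤ r ∧ r < lam.colLen C.j₃) ∨
    (j ≠ C.j₂ ∧ j ≠ C.j₃ ∧ C.label i Y x (r, j) = j ∧
      C.entry i Y x (r, j) = r - al.colLen j + 1 ∧ al.colLen j ≤ r ∧ r < lam.colLen j) := by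
  obtain ⟨h1, h2⟩ := mem_skewDiagram_iff.mp hc
  have := C.lt₂₃
  unfold entry label
  dsimp only
  by_cases hj2 : j = C.j₂
  · subst hj2
    by_cases hk : i ≤ r - al.colLen C.j₂
    · simp [hk, h1, h2]
    · simp [hk, h1, h2, C.lt₂₃.ne', not_le.mp hk]
  · by_cases hj3 : j = C.j₃
    · subst hj3
      by_cases hk : x + Y ≤ r - al.colLen C.j₃ + i
      · simp [hj2, hk, h1, h2]
      · by_cases hk' : x ≤ r - al.colLen C.j₃
        · simp [hj2, hk, hk', h1, h2, not_le.mp hk]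
        · simp [hj2, hk, hk', h1, h2, not_le.mp hk, not_le.mp hk']
    · simp [hj2, hj3, h1, h2]

/-- Compared with the plain filling 1, 2, … of a column, the modified pieces only raise entries,
since i ≤ p, x ≤ i and x + Y ≤ p + q. -/
theorem Admissible.le_entry (h : C.Admissible i X Y x) {r j : ℕ}
    (hc : (r, j) ∈ skewDiagram lam al) : r - al.colLen j + 1 ≤ C.entry i Y x (r, j) := by
  obtain ⟨h1, h2, h3, h4, h5, h6, h7⟩ := h
  rcases entry_label_cases (C := C) (i := i) (Y := Y) (x := x) r j hc with
    ⟨rfl, h⟩ | ⟨rfl, h⟩ | ⟨rfl, h⟩ | ⟨rfl, h⟩ | ⟨rfl, h⟩ | h <;> omega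

/-- Entries grow by one within a piece, and the jumps between pieces go upward: i ≤ p in the second
column, x ≤ i and Y ≤ p + q - i in the third. -/
theorem Admissible.col_strict (h : C.Admissible i X Y x) {r r' j : ℕ} (hr : r < r')
    (hc : (r, j) ∈ skewDiagram lam al) (hc' : (r', j) ∈ skewDiagram lam al) :
    C.entry i Y x (r, j) < C.entry i Y x (r', j) := by
  obtain ⟨h1, h2, h3, h4, h5, h6, h7⟩ := h
  have := C.lt₁₂
  have := C.lt₂₃
  rcases entry_label_cases (C := C) (i := i) (Y := Y) (x := x) r j hc with
    h | h | h | h | h | h <;>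
  rcases entry_label_cases (C := C) (i := i) (Y := Y) (x := x) r' j hc' with
    h' | h' | h' | h' | h' | h' <;> omega

/-- A box with a right neighbour is not in a modified column, so its entry is its plain height in
the column. That height does not decrease to the right, and `le_entry` bounds the neighbour from
below by it. -/
theorem Admissible.row_weak (h : C.Admissible i X Y x) {r j : ℕ}
    (hc : (r, j) ∈ skewDiagram lam al) (hc' : (r, j + 1) ∈ skewDiagram lam al) :
    C.entry i Y x (r, j) ≤ C.entry i Y x (r, j + 1) := by
  have hle := h.le_entry hc'
  have hanti := al.colLen_anti j (j + 1) (Nat.le_succ j)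
  obtain ⟨-, hj2, hj3⟩ := C.right_end r j hc hc'
  rcases entry_label_cases (C := C) (i := i) (Y := Y) (x := x) r j hc with
    h | h | h | h | h | h <;> omega

theorem len_j₁ : C.len X Y x C.j₁ = X := by simp [len]

theorem len_j₂ : C.len X Y x C.j₂ = Y := by simp [len, C.lt₁₂.ne]

theorem len_j₃ : C.len X Y x C.j₃ = x := by simp [len, C.lt₂₃.ne, (C.lt₂₃.trans C.lt₁₂).ne]

theorem len_of_ne {j : ℕ} (h1 : j ≠ C.j₁) (h2 : j ≠ C.j₂) (h3 : j ≠ C.j₃) :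
    C.len X Y x j = lam.colLen j - al.colLen j := by simp [len, h1, h2, h3]

theorem Admissible.entry_le_len (h : C.Admissible i X Y x) (r j : ℕ)
    (hc : (r, j) ∈ skewDiagram lam al) :
    C.entry i Y x (r, j) ≤ C.len X Y x (C.label i Y x (r, j)) := by
  obtain ⟨h1, h2, h3, h4, h5, h6, h7⟩ := h
  rcases entry_label_cases (C := C) (i := i) (Y := Y) (x := x) r j hc with
    h | h | h | h | h | h
  · rw [h.2.1, len_j₁]; omega
  · rw [h.2.1, len_j₂]; omega
  · rw [h.2.1, len_j₁]; omega
  · rw [h.2.1, len_j₂]; omega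
  · rw [h.2.1, len_j₃]; omega
  · rw [h.2.2.1]
    by_cases hj : j = C.j₁
    · subst hj
      rw [len_j₁]; omega
    · rw [len_of_ne hj h.1 h.2.1]; omega

/-- The first chain runs through the first column, the second column below its top i boxes, and the
end of the third. The second chain runs through the top i boxes of the second column and the middle
of the third. -/
theorem Admissible.exists_box (h : C.Admissible i X Y x) (L v : ℕ) (hv : 1 ≤ v)
    (hvL : v ≤ C.len X Y x L) :
    ∃ c ∈ skewDiagram lam al, C.label i Y x c = L ∧ C.entry i Y x c = v := by
  obtain ⟨h1, h2, h3, h4, h5, h6, h7⟩ := h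
  have n1 := C.lt₁₂
  have n2 := C.lt₂₃
  have key : ∀ r j, (r, j) ∈ skewDiagram lam al →
      (C.label i Y x (r, j) = L ∧ C.entry i Y x (r, j) = v) →
      ∃ c ∈ skewDiagram lam al, C.label i Y x c = L ∧ C.entry i Y x c = v :=
    fun r j hm hh => ⟨(r, j), hm, hh⟩
  by_cases hL1 : L = C.j₁
  · subst hL1
    rw [len_j₁] at hvL
    by_cases hp : v ≤ lam.colLen C.j₁ - al.colLen C.j₁
    · have hm : (al.colLen C.j₁ + v - 1, C.j₁) ∈ skewDiagram lam al :=
        mem_skewDiagram_iff.mpr (by omega)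
      refine key _ _ hm ?_
      have := entry_label_cases (C := C) (i := i) (Y := Y) (x := x) _ _ hm
      omega
    · by_cases hq : v + i ≤ lam.colLen C.j₁ - al.colLen C.j₁ +
        (lam.colLen C.j₂ - al.colLen C.j₂)
      · have hm : (al.colLen C.j₂ + i + v - 1 - (lam.colLen C.j₁ - al.colLen C.j₁), C.j₂) ∈
            skewDiagram lam al := mem_skewDiagram_iff.mpr (by omega)
        refine key _ _ hm ?_
        have := entry_label_cases (C := C) (i := i) (Y := Y) (x := x) _ _ hm
        omega
      · have hm : (al.colLen C.j₃ + x + Y + v - 1 - (lam.colLen C.j₁ - al.colLen C.j₁ +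
            (lam.colLen C.j₂ - al.colLen C.j₂)), C.j₃) ∈
            skewDiagram lam al := mem_skewDiagram_iff.mpr (by omega)
        refine key _ _ hm ?_
        have := entry_label_cases (C := C) (i := i) (Y := Y) (x := x) _ _ hm
        omega
  · by_cases hL2 : L = C.j₂
    · subst hL2
      rw [len_j₂] at hvL
      by_cases hp : v ≤ i
      · have hm : (al.colLen C.j₂ + v - 1, C.j₂) ∈ skewDiagram lam al :=
          mem_skewDiagram_iff.mpr (by omega)
        refine key _ _ hm ?_
        have := entry_label_cases (C := C) (i := i) (Y := Y) (x := x) _ _ hm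
        omega
      · have hm : (al.colLen C.j₃ + x + v - 1 - i, C.j₃) ∈ skewDiagram lam al :=
          mem_skewDiagram_iff.mpr (by omega)
        refine key _ _ hm ?_
        have := entry_label_cases (C := C) (i := i) (Y := Y) (x := x) _ _ hm
        omega
    · by_cases hL3 : L = C.j₃
      · subst hL3
        rw [len_j₃] at hvL
        have hm : (al.colLen C.j₃ + v - 1, C.j₃) ∈ skewDiagram lam al :=
          mem_skewDiagram_iff.mpr (by omega)
        refine key _ _ hm ?_
        have := entry_label_cases (C := C) (i := i) (Y := Y) (x := x) _ _ hm
        omega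
      · rw [len_of_ne hL1 hL2 hL3] at hvL
        have hm : (al.colLen L + v - 1, L) ∈ skewDiagram lam al :=
          mem_skewDiagram_iff.mpr (by omega)
        refine key _ _ hm ?_
        have := entry_label_cases (C := C) (i := i) (Y := Y) (x := x) _ _ hm
        omega

/-- As entries increase, a chain moves on only from an earlier to a later column of the triple,
which lies entirely lower; within one column, strictness applies. -/
theorem Admissible.row_le_of_entry_le (h : C.Admissible i X Y x) {r j r' j' : ℕ}
    (hc : (r, j) ∈ skewDiagram lam al) (hc' : (r', j') ∈ skewDiagram lam al)
    (hL : C.label i Y x (r, j) = C.label i Y x (r', j'))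
    (he : C.entry i Y x (r, j) ≤ C.entry i Y x (r', j')) : r < r' ∨ (r = r' ∧ j = j') := by
  obtain ⟨h1, h2, h3, h4, h5, h6, h7⟩ := h
  by_cases hj : j = j'
  · subst hj
    by_contra hcon
    have := Admissible.col_strict ⟨h1, h2, h3, h4, h5, h6, h7⟩ (by omega : r' < r) hc' hc
    omega
  have n1 := C.lt₁₂
  have n2 := C.lt₂₃
  have a1 := C.above₁₂
  have a2 := C.above₂₃
  have b1 := C.nonempty₁
  have b2 := C.nonempty₂
  have b3 := C.nonempty₃
  -- `omega` treats the column lengths as atoms, so their equality when `l` is the first column must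
  -- be supplied.
  have key : ∀ l, l ≠ C.j₁ ∨ (al.colLen l = al.colLen C.j₁ ∧ lam.colLen l = lam.colLen C.j₁) :=
    fun l => (ne_or_eq l C.j₁).imp_right fun h => by simp [h]
  have k := key j
  have k' := key j'
  rcases entry_label_cases (C := C) (i := i) (Y := Y) (x := x) r j hc with
    h | h | h | h | h | h <;>
  rcases entry_label_cases (C := C) (i := i) (Y := Y) (x := x) r' j' hc' with
    h' | h' | h' | h' | h' | h' <;>
  omega

/-- The chains of the filling. -/
def Admissible.chainLabelling (h : C.Admissible i X Y x) :
    ChainLabelling (skewDiagram lam al) (C.entry i Y x) (C.len X Y x) where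
  label := C.label i Y x
  entry_le c hc := h.entry_le_len c.1 c.2 hc
  exists_box := h.exists_box
  injective := by
    rintro ⟨r, j⟩ hc ⟨r', j'⟩ hc' hL he
    have h1 := h.row_le_of_entry_le hc hc' hL he.le
    have h2 := h.row_le_of_entry_le hc' hc hL.symm he.ge
    rw [Prod.mk.injEq]
    omega
  row_lt := by
    rintro ⟨r, j⟩ hc ⟨r', j'⟩ hc' hL he
    rcases h.row_le_of_entry_le hc hc' hL he.le with h1 | ⟨rfl, rfl⟩
    · exact h1
    · exact absurd he (lt_irrefl _)

theorem len_eq_zero (L : ℕ) (hL : lam.rowLen 0 ≤ L) : C.len X Y x L = 0 := by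
  have h0 : lam.colLen L = 0 := by
    by_contra h
    have := YoungDiagram.mem_iff_lt_rowLen.mp
      (YoungDiagram.mem_iff_lt_colLen.mpr (Nat.pos_of_ne_zero h))
    omega
  have b1 := C.nonempty₁
  have b2 := C.nonempty₂
  have b3 := C.nonempty₃
  rw [len_of_ne, h0, Nat.zero_sub]
  all_goals
    rintro rfl
    omega

/-- The filling as a Littlewood-Richardson tableau; its content does not depend on `i`. -/
def Admissible.lrTableau (h : C.Admissible i X Y x) :
    LRTableau lam al (YoungDiagram.ofColumnLengths (lam.rowLen 0) (C.len X Y x)) :=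
  h.chainLabelling.toLRTableau len_eq_zero
    (fun _ hc => (Nat.le_add_left 1 _).trans (h.le_entry hc))
    (fun _ _ hc hc' => h.row_weak hc hc')
    (fun r _ hc hc' => h.col_strict (Nat.lt_succ_self r) hc hc')

/-- The two fillings differ in box number i + 1 of the second column: it holds p + 1 for parameter i
and i + 1 for parameter i + 1, where i < p. -/
theorem Admissible.two_le_lrCoeff (h : C.Admissible i X Y x) (h' : C.Admissible (i + 1) X Y x) :
    2 ≤ lrCoeff lam al (YoungDiagram.ofColumnLengths (lam.rowLen 0) (C.len X Y x)) := by
  refine Finite.one_lt_card_iff_nontrivial.mpr ⟨h.lrTableau, h'.lrTableau, fun heq => ?_⟩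
  have h1 := h'.le_left
  have h2 := h'.le_right
  have n1 := C.lt₂₃
  have hm : (al.colLen C.j₂ + i, C.j₂) ∈ skewDiagram lam al := mem_skewDiagram_iff.mpr (by omega)
  have he : C.entry i Y x (al.colLen C.j₂ + i, C.j₂) =
      C.entry (i + 1) Y x (al.colLen C.j₂ + i, C.j₂) := by
    have := congrFun (congrFun (congrArg LRTableau.entry heq) (al.colLen C.j₂ + i)) C.j₂
    simpa [lrTableau, ChainLabelling.toLRTableau, hm] using this
  have e1 := entry_label_cases (C := C) (i := i) (Y := Y) (x := x) _ _ hm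
  have e2 := entry_label_cases (C := C) (i := i + 1) (Y := Y) (x := x) _ _ hm
  omega

theorem exists_admissible (C : ColumnTriple lam al) :
    ∃ i X Y x, C.Admissible i X Y x ∧ C.Admissible (i + 1) X Y x := by
  have b1 := C.nonempty₁
  have b2 := C.nonempty₂
  have b3 := C.nonempty₃
  obtain ⟨p, hp⟩ : ∃ p, p = lam.colLen C.j₁ - al.colLen C.j₁ := ⟨_, rfl⟩
  obtain ⟨q, hq⟩ : ∃ q, q = lam.colLen C.j₂ - al.colLen C.j₂ := ⟨_, rfl⟩
  obtain ⟨r, hr⟩ : ∃ r, r = lam.colLen C.j₃ - al.colLen C.j₃ := ⟨_, rfl⟩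
  -- The largest length grows by one, the smallest shrinks by one, and the median stays. The bound p
  -- + q ≤ X + i at i = min(p,q) - 1 is what forces the extra 1 in X when the maximum is p or q.
  refine ⟨min p q - 1, max p (max q r) + 1, p + q + r - max p (max q r) - min p (min q r),
    min p (min q r) - 1, ?_, ?_⟩ <;> constructor <;> (try simp only [← hp, ← hq, ← hr]) <;> omega

end ColumnTriple

/-! ## The last columns of the components -/

namespace DecomposesInto

variable {lam al : YoungDiagram} {k : ℕ} {A : Fin k → Finset (ℕ × ℕ)}

theorem exists_last_column (hA : DecomposesInto (skewDiagram lam al) A) :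
    ∃ J : Fin k → ℕ, ∀ p, (∃ r, (r, J p) ∈ A p) ∧ ∀ b ∈ A p, b.2 ≤ J p := by
  refine ⟨fun p => (A p).sup Prod.snd, fun p => ⟨?_, fun b hb => Finset.le_sup hb⟩⟩
  obtain ⟨⟨r, j⟩, hb, h⟩ := Finset.exists_mem_eq_sup (A p) (hA.nonempty p) Prod.snd
  exact ⟨r, by simpa only [h] using hb⟩

theorem subset (hA : DecomposesInto (skewDiagram lam al) A) (p : Fin k) :
    A p ⊆ skewDiagram lam al := by
  rw [hA.union]
  exact Finset.subset_biUnion_of_mem A (Finset.mem_univ p)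

theorem mem_of_col_eq (hA : DecomposesInto (skewDiagram lam al) A) {p : Fin k} {b c : ℕ × ℕ}
    (hb : b ∈ A p) (hc : c ∈ skewDiagram lam al) (h : b.2 = c.2) : c ∈ A p := by
  rw [hA.union] at hc
  obtain ⟨q, -, hq⟩ := Finset.mem_biUnion.mp hc
  by_cases hpq : p = q
  · rwa [hpq]
  · exact absurd h (hA.disconnected p q hpq b hb c hq).2

theorem mem_of_row_eq (hA : DecomposesInto (skewDiagram lam al) A) {p : Fin k} {b c : ℕ × ℕ}
    (hb : b ∈ A p) (hc : c ∈ skewDiagram lam al) (h : b.1 = c.1) : c ∈ A p := by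
  rw [hA.union] at hc
  obtain ⟨q, -, hq⟩ := Finset.mem_biUnion.mp hc
  by_cases hpq : p = q
  · rwa [hpq]
  · exact absurd h (hA.disconnected p q hpq b hb c hq).1

theorem colLen_lt_colLen (hA : DecomposesInto (skewDiagram lam al) A) {p : Fin k} {r j : ℕ}
    (h : (r, j) ∈ A p) : al.colLen j < lam.colLen j := by
  have := mem_skewDiagram_iff.mp (hA.subset p h)
  omega

/-- Otherwise the row of the top box of column `l` would also meet column `j` in the diagram, and
two components would share a row. -/
theorem colLen_le_colLen (hA : DecomposesInto (skewDiagram lam al) A) {p q : Fin k}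
    {r s j l : ℕ} (hp : (r, j) ∈ A p) (hq : (s, l) ∈ A q) (hpq : p ≠ q) (hlj : l < j) :
    lam.colLen j ≤ al.colLen l := by
  by_contra! hlt
  have hl : (al.colLen l, l) ∈ skewDiagram lam al :=
    mem_skewDiagram_iff.mpr ⟨le_rfl, hA.colLen_lt_colLen hq⟩
  have hj : (al.colLen l, j) ∈ skewDiagram lam al :=
    mem_skewDiagram_iff.mpr ⟨al.colLen_anti l j hlj.le, hlt⟩
  exact (hA.disconnected p q hpq _ (hA.mem_of_col_eq hp hj rfl) _
    (hA.mem_of_col_eq hq hl rfl)).1 rfl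

theorem nonempty_columnTriple (hk : 3 ≤ k) (hA : DecomposesInto (skewDiagram lam al) A) :
    Nonempty (ColumnTriple lam al) := by
  obtain ⟨J, hJ⟩ := hA.exists_last_column
  have hne : ∀ p q, p ≠ q → J p ≠ J q := fun p q hpq => by
    obtain ⟨r, hr⟩ := (hJ p).1
    obtain ⟨s, hs⟩ := (hJ q).1
    exact (hA.disconnected p q hpq _ hr _ hs).2
  -- A right neighbour would share a row with the component, hence belong to it, beyond its last
  -- column.
  have hend : ∀ p i j, (i, j) ∈ skewDiagram lam al → (i, j + 1) ∈ skewDiagram lam al →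
      j ≠ J p := by
    rintro p i _ hc hc' rfl
    obtain ⟨r, hr⟩ := (hJ p).1
    have := (hJ p).2 _ (hA.mem_of_row_eq (hA.mem_of_col_eq hr hc rfl) hc' rfl)
    omega
  have build : ∀ a b c, J c < J b → J b < J a → Nonempty (ColumnTriple lam al) := by
    intro a b c hcb hba
    obtain ⟨r, hr⟩ := (hJ a).1
    obtain ⟨s, hs⟩ := (hJ b).1
    obtain ⟨t, ht⟩ := (hJ c).1
    exact ⟨{
      j₁ := J a
      j₂ := J b
      j₃ := J c
      lt₁₂ := hba
      lt₂₃ := hcb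
      nonempty₁ := hA.colLen_lt_colLen hr
      nonempty₂ := hA.colLen_lt_colLen hs
      nonempty₃ := hA.colLen_lt_colLen ht
      above₁₂ := hA.colLen_le_colLen hr hs (by rintro rfl; omega) hba
      above₂₃ := hA.colLen_le_colLen hs ht (by rintro rfl; omega) hcb
      right_end := fun i j h h' => ⟨hend a i j h h', hend b i j h h', hend c i j h h'⟩ }⟩
  -- Any three components do; sorting their last columns from right to left orders them from top to
  -- bottom.
  let a : Fin k := ⟨0, by omega⟩
  let b : Fin k := ⟨1, by omega⟩
  let c : Fin k := ⟨2, by omega⟩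
  rcases lt_or_gt_of_ne (hne a b (by simp [a, b])) with h1 | h1 <;>
  rcases lt_or_gt_of_ne (hne a c (by simp [a, c])) with h2 | h2 <;>
  rcases lt_or_gt_of_ne (hne b c (by simp [b, c])) with h3 | h3
  · exact build c b a h1 h3
  · exact build b c a h2 h3
  · omega
  · exact build b a c h2 h1
  · exact build c a b h1 h2
  · omega
  · exact build a c b h3 h2
  · exact build a b c h3 h1

end DecomposesInto

theorem proposition3p6 (lam al : YoungDiagram) (hal : al ≤ lam)
    (k : ℕ) (hk : 3 ≤ k) (A : Fin k → Finset (ℕ × ℕ))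
    (hA : DecomposesInto (skewDiagram lam al) A) :
    ¬ IsMultiplicityFree (skewCharacter lam al) := by
  obtain ⟨C⟩ := hA.nonempty_columnTriple hk
  obtain ⟨i, X, Y, x, h, h'⟩ := C.exists_admissible
  exact not_isMultiplicityFree_skewCharacter h.lrTableau.card_eq (h.two_le_lrCoeff h')
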